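/- Let $n\ge 2$, $s\in(0,1)$ and $p\in(1,\infty)$. Then there is a continuous map $\tilde f\colon[-1,1]^n\to\mathbb R^n$ belonging to the fractional Sobolev space $W^{s,p}([-1,1]^n,\mathbb R^n)$, i.e. $\tilde f\in L^p$ and $$\int_{[-1,1]^n}\int_{[-1,1]^n}\frac{|\tilde f(x)-\tilde f(y)|^p}{|x-y|^{n+sp}}\,dy\,dx<\infty ,$$ such that $\tilde f$ is (classically) differentiable at almost every $x\in[-1,1]^n$ with $\det\nabla\tilde f(x)>0$ for almost every $x$, such that $$\tilde f(x)=(-x_1,x_2,\dots,x_n)\quad\text{for every }x\in\partial[-1,1]^n,$$ and such that $\tilde f$ is not sense-preserving on $(-1,1)^n$. Here a continuous map $f\colon\Omega\to\mathbb R^n$ on an open set $\Omega\subset\mathbb R^n$ is called sense-preserving if the topological (Brouwer) degree satisfies $\deg(f,U,y)>0$ for every domain $U\subset\subset\Omega$ and every $y\in f(U)\setminus f(\partial U)$. -/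

import Mathlib

open MeasureTheory

noncomputable section

/-- The closed cube `[-1,1]ⁿ` in Euclidean `n`-space. -/
def closedCube (n : ℕ) : Set (EuclideanSpace ℝ (Fin n)) := {x | ∀ i, |x i| ≤ 1}

/-- The open cube `(-1,1)ⁿ` in Euclidean `n`-space. -/
def openCube (n : ℕ) : Set (EuclideanSpace ℝ (Fin n)) := {x | ∀ i, |x i| < 1}

/-- The reflection `(x₁, x₂, …, xₙ) ↦ (-x₁, x₂, …, xₙ)`. -/
def reflectFirst {n : ℕ} (x : EuclideanSpace ℝ (Fin n)) : EuclideanSpace ℝ (Fin n) :=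
  WithLp.toLp 2 fun i => if (i : ℕ) = 0 then -x i else x i

/-- The Gagliardo energy `∫_Ω ∫_Ω |f x - f y|^p / |x - y|^(n + s p) dy dx`. -/
def gagliardoEnergy {n m : ℕ} (s p : ℝ) (Ω : Set (EuclideanSpace ℝ (Fin n)))
    (f : EuclideanSpace ℝ (Fin n) → EuclideanSpace ℝ (Fin m)) : ENNReal :=
  ∫⁻ x in Ω, ∫⁻ y in Ω, ENNReal.ofReal (‖f x - f y‖ ^ p / ‖x - y‖ ^ ((n : ℝ) + s * p))

/-- Membership in the fractional (Sobolev–Slobodeckij) space `W^{s,p}(Ω, ℝᵐ)`. -/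
def MemFracSobolev {n m : ℕ} (s p : ℝ) (Ω : Set (EuclideanSpace ℝ (Fin n)))
    (f : EuclideanSpace ℝ (Fin n) → EuclideanSpace ℝ (Fin m)) : Prop :=
  MemLp f (ENNReal.ofReal p) (volume.restrict Ω) ∧ gagliardoEnergy s p Ω f < ⊤

/-- `y` is a regular value of `g` on `U`. -/
def IsRegularValueOn {n : ℕ} (g : EuclideanSpace ℝ (Fin n) → EuclideanSpace ℝ (Fin n))
    (U : Set (EuclideanSpace ℝ (Fin n))) (y : EuclideanSpace ℝ (Fin n)) : Prop :=
  ∀ x ∈ U, g x = y → (fderiv ℝ g x).det ≠ 0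

/-- The degree of a smooth map `g` on `U` at a regular value `y`: the sum of the signs of the
Jacobian over the preimages of `y` in `U`. -/
def smoothDegree {n : ℕ} (g : EuclideanSpace ℝ (Fin n) → EuclideanSpace ℝ (Fin n))
    (U : Set (EuclideanSpace ℝ (Fin n))) (y : EuclideanSpace ℝ (Fin n)) : ℤ :=
  ∑ᶠ x ∈ {x | x ∈ U ∧ g x = y}, ((SignType.sign (fderiv ℝ g x).det : SignType) : ℤ)

/-- `deg(f, U, y) = d`, for `U` bounded and open, `f` continuous on `closure U` and
`y ∉ f(∂U)`: the degree of `f` is that of any smooth map `g` with regular value `y` such that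
`|g - f| < dist(y, f(∂U))` on `closure U`. Such a `g` exists and the integer `d` does not depend
on it (homotopy invariance), so this relation is the graph of the Brouwer degree. -/
def HasBrouwerDegree {n : ℕ} (f : EuclideanSpace ℝ (Fin n) → EuclideanSpace ℝ (Fin n))
    (U : Set (EuclideanSpace ℝ (Fin n))) (y : EuclideanSpace ℝ (Fin n)) (d : ℤ) : Prop :=
  ∃ g : EuclideanSpace ℝ (Fin n) → EuclideanSpace ℝ (Fin n),
    ContDiff ℝ (⊤ : ℕ∞) g ∧
    (∀ x ∈ closure U, ‖g x - f x‖ < Metric.infDist y (f '' frontier U)) ∧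
    IsRegularValueOn g U y ∧
    smoothDegree g U y = d

/-- A continuous map `f` on the open set `Ω` is sense-preserving if `deg(f, U, y) > 0` for all
domains `U ⊂⊂ Ω` and all `y ∈ f(U) \ f(∂U)`. -/
def SensePreserving {n : ℕ} (f : EuclideanSpace ℝ (Fin n) → EuclideanSpace ℝ (Fin n))
    (Ω : Set (EuclideanSpace ℝ (Fin n))) : Prop :=
  ∀ U : Set (EuclideanSpace ℝ (Fin n)), IsOpen U → IsConnected U →
    IsCompact (closure U) → closure U ⊆ Ω →
    ∀ y ∈ f '' U \ f '' frontier U, ∀ d : ℤ, HasBrouwerDegree f U y d → 0 < d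

end

open Filter Topology Set

/-- The self-similarity operator whose fixed point is the Cantor function of ratio `r`. -/
noncomputable def staircaseStep (r : ℝ) (f : ℝ → ℝ) (x : ℝ) : ℝ :=
  f (x / r) / 2 + f ((x - (1 - r)) / r) / 2

/-- The properties of a distribution function on `[0, 1]` with Hölder exponent `a` that are
preserved by `staircaseStep` and by pointwise limits. -/
structure IsHolderStaircase (K a : ℝ) (f : ℝ → ℝ) : Prop where
  eq_zero : ∀ x ≤ 0, f x = 0
  eq_one : ∀ x, 1 ≤ x → f x = 1
  nonneg : ∀ x, 0 ≤ f x
  le_one : ∀ x, f x ≤ 1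
  holder : ∀ x y, x ≤ y → |f x - f y| ≤ K * (y - x) ^ a

lemma IsHolderStaircase.step {K a r : ℝ} {f : ℝ → ℝ} (hf : IsHolderStaircase K a f)
    (ha : 0 < a) (hr : 0 < r) (hr2 : r < 1 / 2) (hra : r ^ a = 1 / 2)
    (hK : 1 ≤ K * (1 - 2 * r) ^ a) : IsHolderStaircase K a (staircaseStep r f) := by
  have hK0 : 0 ≤ K := by
    have : 0 < (1 - 2 * r) ^ a := Real.rpow_pos_of_pos (by linarith) _
    by_contra! h
    nlinarith
  have key : ∀ x y, x ≤ y → ∀ b, |f ((x - b) / r) - f ((y - b) / r)| / 2 ≤ K * (y - x) ^ a := by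
    intro x y hxy b
    have h := hf.holder ((x - b) / r) ((y - b) / r) (by gcongr)
    have e : (y - b) / r - (x - b) / r = (y - x) / r := by ring
    rw [e, Real.div_rpow (by linarith) hr.le, hra] at h
    linarith
  have nn := hf.nonneg
  have lo := hf.le_one
  refine ⟨fun x hx => ?_, fun x hx => ?_, fun x => ?_, fun x => ?_, fun x y hxy => ?_⟩
  · unfold staircaseStep
    rw [hf.eq_zero _ (div_nonpos_of_nonpos_of_nonneg hx hr.le),
      hf.eq_zero _ (div_nonpos_of_nonpos_of_nonneg (by linarith) hr.le)]
    norm_num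
  · unfold staircaseStep
    rw [hf.eq_one _ (by rw [le_div_iff₀ hr]; linarith),
      hf.eq_one _ (by rw [le_div_iff₀ hr]; linarith)]
    norm_num
  · unfold staircaseStep
    linarith [nn (x / r), nn ((x - (1 - r)) / r)]
  · unfold staircaseStep
    linarith [lo (x / r), lo ((x - (1 - r)) / r)]
  · unfold staircaseStep
    rcases le_or_gt (1 - 2 * r) (y - x) with h | h
    · have h1 : (1 - 2 * r) ^ a ≤ (y - x) ^ a := Real.rpow_le_rpow (by linarith) h ha.le
      have h2 : 1 ≤ K * (y - x) ^ a := hK.trans (by gcongr)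
      refine le_trans ?_ h2
      rw [abs_le]
      constructor <;>
      linarith [lo (x / r), lo ((x - (1 - r)) / r), lo (y / r), lo ((y - (1 - r)) / r),
        nn (x / r), nn ((x - (1 - r)) / r), nn (y / r), nn ((y - (1 - r)) / r)]
    · rcases le_or_gt r x with hx | hx
      · rw [hf.eq_one (x / r) (by rw [le_div_iff₀ hr]; linarith),
          hf.eq_one (y / r) (by rw [le_div_iff₀ hr]; linarith), add_sub_add_left_eq_sub, ← sub_div,
          abs_div, abs_two]
        exact key x y hxy _
      · rw [hf.eq_zero ((x - (1 - r)) / r) (div_nonpos_of_nonpos_of_nonneg (by linarith) hr.le),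
          hf.eq_zero ((y - (1 - r)) / r) (div_nonpos_of_nonpos_of_nonneg (by linarith) hr.le),
          add_sub_add_right_eq_sub, ← sub_div, abs_div, abs_two]
        simpa using key x y hxy 0

lemma abs_staircaseStep_sub_le {K a r B : ℝ} {f g : ℝ → ℝ} (hf : IsHolderStaircase K a f)
    (hg : IsHolderStaircase K a g) (hr : 0 < r) (hr2 : r < 1 / 2)
    (h : ∀ x, |f x - g x| ≤ B) (x : ℝ) : |staircaseStep r f x - staircaseStep r g x| ≤ B / 2 := by
  unfold staircaseStep
  rcases le_or_gt r x with hx | hx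
  · rw [hf.eq_one (x / r) (by rw [le_div_iff₀ hr]; linarith),
      hg.eq_one (x / r) (by rw [le_div_iff₀ hr]; linarith), add_sub_add_left_eq_sub, ← sub_div,
      abs_div, abs_two]
    gcongr
    exact h _
  · rw [hf.eq_zero ((x - (1 - r)) / r) (div_nonpos_of_nonpos_of_nonneg (by linarith) hr.le),
      hg.eq_zero ((x - (1 - r)) / r) (div_nonpos_of_nonpos_of_nonneg (by linarith) hr.le),
      add_sub_add_right_eq_sub, ← sub_div, abs_div, abs_two]
    gcongr
    exact h _

lemma isHolderStaircase_clamp {K a : ℝ} (hK : 1 ≤ K) (ha : 0 < a) (ha1 : a ≤ 1) :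
    IsHolderStaircase K a (fun x => max 0 (min 1 x)) := by
  refine ⟨fun x hx => ?_, fun x hx => ?_, fun x => ?_, fun x => ?_, fun x y hxy => ?_⟩
  · simp [hx]
  · simp [hx]
  · simp
  · simp
  · have h1 : |max 0 (min 1 x) - max 0 (min 1 y)| ≤ min 1 (y - x) := by
      rcases le_total 1 x with h1 | h1 <;> rcases le_total 1 y with h2 | h2 <;>
      rcases le_total 0 x with h3 | h3 <;> rcases le_total 0 y with h4 | h4 <;>
      simp only [h1, h2, h3, h4, min_eq_left, min_eq_right, max_eq_left, max_eq_right,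
        zero_le_one] <;> rw [abs_le] <;> refine ⟨?_, le_min ?_ ?_⟩ <;>
        first | linarith | (rw [neg_le]; refine le_min ?_ ?_ <;> linarith)
    have h0 : 0 ≤ y - x := sub_nonneg.2 hxy
    have hp : 0 ≤ (y - x) ^ a := Real.rpow_nonneg h0 _
    refine h1.trans (le_trans ?_ (le_mul_of_one_le_left hp hK))
    rcases le_total (y - x) 1 with h | h
    · refine (min_le_right _ _).trans ?_
      rcases h0.eq_or_lt with h0' | h0'
      · rw [← h0', Real.zero_rpow ha.ne']
      · simpa using Real.rpow_le_rpow_of_exponent_ge h0' h ha1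
    · exact (min_le_left _ _).trans (Real.one_le_rpow h ha.le)

lemma exists_cantor_fixedPoint {K a r : ℝ} (ha : 0 < a) (ha1 : a ≤ 1) (hr : 0 < r)
    (hr2 : r < 1 / 2) (hra : r ^ a = 1 / 2) (hK1 : 1 ≤ K) (hK : 1 ≤ K * (1 - 2 * r) ^ a) :
    ∃ c : ℝ → ℝ, IsHolderStaircase K a c ∧ ∀ x, c x = staircaseStep r c x := by
  let F : ℕ → ℝ → ℝ := fun k => (staircaseStep r)^[k] (fun x => max 0 (min 1 x))
  have hFs : ∀ k, F (k + 1) = staircaseStep r (F k) := fun k => Function.iterate_succ_apply' _ _ _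
  have hF : ∀ k, IsHolderStaircase K a (F k) := by
    intro k
    induction k with
    | zero => exact isHolderStaircase_clamp hK1 ha ha1
    | succ k ih => rw [hFs]; exact ih.step ha hr hr2 hra hK
  have hdist : ∀ k x, |F k x - F (k + 1) x| ≤ 1 * (1 / 2) ^ k := by
    intro k
    induction k with
    | zero =>
      intro x
      rw [pow_zero, mul_one, abs_le]
      constructor <;>
      linarith [(hF 0).nonneg x, (hF 0).le_one x, (hF 1).nonneg x, (hF 1).le_one x]
    | succ k ih =>
      intro x
      rw [hFs (k + 1), hFs k]
      refine (abs_staircaseStep_sub_le (hF k) (by rw [← hFs]; exact hF (k + 1)) hr hr2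
        (B := 1 * (1 / 2) ^ k) (fun x => ?_) x).trans (by rw [pow_succ]; linarith)
      rw [← hFs]
      exact ih x
  have hlim : ∀ x, ∃ l, Tendsto (fun k => F k x) atTop (𝓝 l) := fun x =>
    cauchySeq_tendsto_of_complete
      (cauchySeq_of_le_geometric (1 / 2) 1 (by norm_num) (fun k => hdist k x))
  choose c hc using hlim
  refine ⟨c, ⟨fun x hx => ?_, fun x hx => ?_, fun x => ?_, fun x => ?_, fun x y hxy => ?_⟩,
    fun x => ?_⟩
  · exact tendsto_nhds_unique (hc x) (by simp [(hF _).eq_zero x hx])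
  · exact tendsto_nhds_unique (hc x) (by simp [(hF _).eq_one x hx])
  · exact ge_of_tendsto' (hc x) fun k => (hF k).nonneg x
  · exact le_of_tendsto' (hc x) fun k => (hF k).le_one x
  · exact le_of_tendsto' ((hc x).sub (hc y)).abs fun k => (hF k).holder x y hxy
  · refine tendsto_nhds_unique ((hc x).comp (tendsto_add_atTop_nat 1)) ?_
    have : (fun k => F k x) ∘ (fun k => k + 1) = fun k => staircaseStep r (F k) x := by
      funext k
      simp [hFs]
    rw [this]
    exact ((hc _).div_const 2).add ((hc _).div_const 2)

/-- The fixed point of `staircaseStep` has derivative zero almost everywhere: the exceptional set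
`Z ⊆ (0, 1)` is covered, up to two points, by two copies of itself scaled by `r < 1 / 2`. -/
lemma ae_hasDerivAt_zero_of_staircaseStep {K a r : ℝ} {c : ℝ → ℝ} (hc : IsHolderStaircase K a c)
    (hr : 0 < r) (hr2 : r < 1 / 2) (hfix : ∀ x, c x = staircaseStep r c x) :
    ∀ᵐ x : ℝ, HasDerivAt c 0 x := by
  set Z : Set ℝ := {x | x ∈ Ioo 0 1 ∧ ¬ HasDerivAt c 0 x} with hZ
  have hleft : ∀ x < 1 - r, c x = c (x / r) / 2 := by
    intro x hx
    rw [hfix x, staircaseStep, hc.eq_zero ((x - (1 - r)) / r)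
      (div_nonpos_of_nonpos_of_nonneg (by linarith) hr.le)]
    ring
  have hright : ∀ x, r < x → c x = 1 / 2 + c ((x - (1 - r)) / r) / 2 := by
    intro x hx
    rw [hfix x, staircaseStep, hc.eq_one (x / r) (by rw [le_div_iff₀ hr]; linarith)]
  have hcover : Z ⊆ ((fun x => r * x) '' Z ∪ (fun x => (1 - r) + x) '' ((fun x => r * x) '' Z))
      ∪ {r, 1 - r} := by
    rintro x ⟨⟨hx0, hx1⟩, hx⟩
    by_cases h1 : x = r
    · right; simp [h1]
    by_cases h2 : x = 1 - r
    · right; simp [h2]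
    left
    rcases lt_or_gt_of_ne h1 with h1 | h1
    · left
      refine ⟨x / r, ⟨⟨by positivity, by rwa [div_lt_one hr]⟩, fun hd => hx ?_⟩, by field_simp⟩
      have e : c =ᶠ[𝓝 x] fun y => c (y / r) / 2 := by
        filter_upwards [Iio_mem_nhds (show x < 1 - r by linarith)] with y hy using hleft y hy
      refine HasDerivAt.congr_of_eventuallyEq ?_ e
      have := (hd.comp x ((hasDerivAt_id x).div_const r)).div_const 2
      simpa [Function.comp_def] using this
    rcases lt_or_gt_of_ne h2 with h2 | h2
    · exfalso
      apply hx
      have e : c =ᶠ[𝓝 x] fun y => 1 / 2 := by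
        filter_upwards [Ioo_mem_nhds h1 h2] with y hy
        rw [hleft y hy.2, hc.eq_one (y / r) (by rw [le_div_iff₀ hr]; linarith [hy.1])]
      exact (hasDerivAt_const x (1 / 2 : ℝ)).congr_of_eventuallyEq e
    · right
      refine ⟨x - (1 - r), ⟨(x - (1 - r)) / r, ⟨⟨div_pos (by linarith) hr, ?_⟩,
        fun hd => hx ?_⟩, by field_simp⟩, by ring⟩
      · rw [div_lt_one hr]; linarith
      have e : c =ᶠ[𝓝 x] fun y => 1 / 2 + c ((y - (1 - r)) / r) / 2 := by
        filter_upwards [Ioi_mem_nhds (show r < x by linarith)] with y hy using hright y hy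
      refine HasDerivAt.congr_of_eventuallyEq ?_ e
      have := ((hd.comp x (((hasDerivAt_id x).sub_const (1 - r)).div_const r)).div_const
        2).const_add (1 / 2)
      simpa [Function.comp_def] using this
  have hZfin : volume Z ≠ ⊤ := by
    refine ne_top_of_le_ne_top ?_ (measure_mono (fun x hx => hx.1 : Z ⊆ Ioo 0 1))
    simp
  have hscale : volume ((fun x => r * x) '' Z) = ENNReal.ofReal r * volume Z := by
    have := Measure.addHaar_smul (volume : Measure ℝ) r Z
    simpa [abs_of_pos hr, ← Set.image_smul] using this
  have hle : volume Z ≤ ENNReal.ofReal (2 * r) * volume Z := by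
    calc volume Z ≤ _ := measure_mono hcover
      _ ≤ _ := measure_union_le _ _
      _ ≤ (volume ((fun x => r * x) '' Z) +
          volume ((fun x => (1 - r) + x) '' ((fun x => r * x) '' Z))) + 0 := by
        gcongr
        · exact measure_union_le _ _
        · exact ((Set.toFinite {r, 1 - r}).measure_zero volume).le
      _ = ENNReal.ofReal (2 * r) * volume Z := by
        rw [Set.image_add_left, measure_preimage_add, hscale, add_zero, ← two_mul, ← mul_assoc,
          ENNReal.ofReal_mul zero_le_two, ENNReal.ofReal_ofNat]
  have hZ0 : volume Z = 0 := by
    by_contra h0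
    have : ENNReal.ofReal (2 * r) * volume Z < 1 * volume Z := by
      rw [ENNReal.mul_lt_mul_iff_left h0 hZfin, ← ENNReal.ofReal_one]
      exact (ENNReal.ofReal_lt_ofReal_iff one_pos).2 (by linarith)
    rw [one_mul] at this
    exact absurd hle this.not_ge
  have hZae : ∀ᵐ x : ℝ, x ∉ Z := measure_eq_zero_iff_ae_notMem.1 hZ0
  filter_upwards [hZae, Measure.ae_ne volume (0 : ℝ), Measure.ae_ne volume (1 : ℝ)] with x hx h0 h1
  rcases lt_or_gt_of_ne h0 with h0 | h0
  · refine (hasDerivAt_const x (0 : ℝ)).congr_of_eventuallyEq ?_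
    filter_upwards [Iio_mem_nhds h0] with y hy using hc.eq_zero y (le_of_lt hy)
  rcases lt_or_gt_of_ne h1 with h1 | h1
  · by_contra h
    exact hx ⟨⟨h0, h1⟩, h⟩
  · refine (hasDerivAt_const x (1 : ℝ)).congr_of_eventuallyEq ?_
    filter_upwards [Ioi_mem_nhds h1] with y hy using hc.eq_one y (le_of_lt hy)

/-- For every `a < 1` there is a singular `a`-Hölder distribution function on `[0, 1]`. -/
theorem exists_singular_holder {a : ℝ} (ha : 0 < a) (ha1 : a < 1) :
    ∃ (K : ℝ) (c : ℝ → ℝ), 1 ≤ K ∧ IsHolderStaircase K a c ∧ ∀ᵐ x : ℝ, HasDerivAt c 0 x := by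
  set r : ℝ := (1 / 2 : ℝ) ^ (1 / a) with hr
  have hr0 : 0 < r := by positivity
  have hr2 : r < 1 / 2 := by
    have := Real.rpow_lt_rpow_of_exponent_gt (x := (1 / 2 : ℝ)) (by norm_num) (by norm_num)
      (show 1 < 1 / a by rwa [lt_div_iff₀ ha, one_mul])
    simpa [hr] using this
  have hra : r ^ a = 1 / 2 := by
    rw [hr, ← Real.rpow_mul (by norm_num), one_div_mul_cancel ha.ne', Real.rpow_one]
  have hg : 0 < (1 - 2 * r) ^ a := Real.rpow_pos_of_pos (by linarith) _
  have hK1 : 1 ≤ ((1 - 2 * r) ^ a)⁻¹ := by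
    rw [one_le_inv₀ hg]
    exact Real.rpow_le_one (by linarith) (by linarith) ha.le
  obtain ⟨c, hc, hfix⟩ := exists_cantor_fixedPoint ha ha1.le hr0 hr2 hra hK1
    (inv_mul_cancel₀ hg.ne').ge
  exact ⟨_, c, hK1, hc, ae_hasDerivAt_zero_of_staircaseStep hc hr0 hr2 hfix⟩

/-- For every `a < 1` there is a `1`-periodic, `a`-Hölder function vanishing on the integers whose
derivative is `-1` almost everywhere. -/
theorem exists_periodic_holder_deriv_neg_one {a : ℝ} (ha : 0 < a) (ha1 : a < 1) :
    ∃ (C : ℝ) (u : ℝ → ℝ), 0 ≤ C ∧ (∀ x, |u x| ≤ 1) ∧ (∀ m : ℤ, u m = 0) ∧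
      (∀ x y, |u x - u y| ≤ C * |x - y| ^ a) ∧ ∀ᵐ x : ℝ, HasDerivAt u (-1) x := by
  obtain ⟨K, c, hK, hc, hderiv⟩ := exists_singular_holder ha ha1
  have hclamp := isHolderStaircase_clamp le_rfl ha ha1.le
  set v : ℝ → ℝ := fun x => c x - max 0 (min 1 x) with hv
  have hv0 : v 0 = 0 := by simp [hv, hc.eq_zero 0 le_rfl]
  have hv1 : v 1 = 0 := by simp [hv, hc.eq_one 1 le_rfl]
  have hvh : ∀ x y, x ≤ y → |v x - v y| ≤ (K + 1) * (y - x) ^ a := by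
    intro x y hxy
    have e : v x - v y = (c x - c y) - (max 0 (min 1 x) - max 0 (min 1 y)) := by
      simp only [hv]; ring
    rw [e, add_mul]
    exact (abs_sub _ _).trans (add_le_add (hc.holder x y hxy) (hclamp.holder x y hxy))
  have hvf : ∀ t, v (Int.fract t) = c (Int.fract t) - Int.fract t := fun t => by
    simp [hv, (Int.fract_lt_one t).le, Int.fract_nonneg t]
  have hmain : ∀ x y, x ≤ y →
      |v (Int.fract x) - v (Int.fract y)| ≤ 2 * (K + 1) * (y - x) ^ a := by
    intro x y hxy
    have hpos : 0 ≤ (K + 1) * (y - x) ^ a :=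
      mul_nonneg (by linarith) (Real.rpow_nonneg (by linarith) _)
    rcases (Int.floor_mono hxy).eq_or_lt with h | h
    · have e : Int.fract y - Int.fract x = y - x := by
        rw [Int.fract, Int.fract, h]; ring
      have := hvh (Int.fract x) (Int.fract y) (by linarith)
      rw [e] at this
      linarith
    · have h' : (⌊x⌋ : ℝ) + 1 ≤ ⌊y⌋ := by exact_mod_cast h
      have hy := Int.floor_le y
      have hx := Int.lt_floor_add_one x
      have hxl := Int.floor_le x
      have h1 : |v (Int.fract x)| ≤ (K + 1) * (y - x) ^ a := by
        have := hvh (Int.fract x) 1 (Int.fract_lt_one x).le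
        rw [hv1, sub_zero] at this
        refine this.trans ?_
        have : 1 - Int.fract x ≤ y - x := by rw [Int.fract]; linarith
        have := sub_nonneg.2 (Int.fract_lt_one x).le
        gcongr
      have h2 : |v (Int.fract y)| ≤ (K + 1) * (y - x) ^ a := by
        have := hvh 0 (Int.fract y) (Int.fract_nonneg y)
        rw [hv0, zero_sub, abs_neg, sub_zero] at this
        refine this.trans ?_
        have : Int.fract y ≤ y - x := by rw [Int.fract]; linarith
        have := Int.fract_nonneg y
        gcongr
      have := abs_sub (v (Int.fract x)) (v (Int.fract y))
      linarith
  refine ⟨2 * (K + 1), fun t => v (Int.fract t), by linarith, fun x => ?_, fun m => ?_,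
    fun x y => ?_, ?_⟩
  · simp only [hvf, abs_le]
    constructor <;> linarith [hc.nonneg (Int.fract x), hc.le_one (Int.fract x),
      Int.fract_nonneg x, Int.fract_lt_one x]
  · simp [hv0]
  · rcases le_total x y with h | h
    · rw [abs_sub_comm x y, abs_of_nonneg (sub_nonneg.2 h)]
      exact hmain x y h
    · rw [abs_sub_comm, abs_of_nonneg (sub_nonneg.2 h)]
      exact hmain y x h
  · have h1 : ∀ᵐ x : ℝ, ∀ m : ℤ, HasDerivAt c 0 (x - m) := by
      rw [ae_all_iff]
      intro m
      exact (measurePreserving_sub_right volume (m : ℝ)).quasiMeasurePreserving.ae hderiv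
    have h2 : ∀ᵐ x : ℝ, ∀ m : ℤ, x ≠ m := by
      rw [ae_all_iff]
      exact fun m => Measure.ae_ne volume _
    filter_upwards [h1, h2] with x hx hxm
    have hlt : (⌊x⌋ : ℝ) < x := lt_of_le_of_ne (Int.floor_le x) (hxm _).symm
    have e : (fun t => v (Int.fract t)) =ᶠ[𝓝 x] fun y => c (y - ⌊x⌋) - (y - ⌊x⌋) := by
      filter_upwards [Ioo_mem_nhds hlt (Int.lt_floor_add_one x)] with y hy
      have : ⌊y⌋ = ⌊x⌋ := Int.floor_eq_iff.2 ⟨hy.1.le, hy.2⟩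
      rw [hvf, Int.fract, this]
    refine HasDerivAt.congr_of_eventuallyEq ?_ e
    have hid := (hasDerivAt_id x).sub_const (⌊x⌋ : ℝ)
    have := ((hx ⌊x⌋).comp x hid).fun_sub hid
    simpa [Function.comp_def] using this

lemma smoothTransition_lipschitz : ∃ L : NNReal, LipschitzWith L Real.smoothTransition := by
  obtain ⟨L, hL⟩ := (Real.smoothTransition.contDiff (n := 1)).contDiffOn.exists_lipschitzOnWith
    (by simp) (convex_Icc (0 : ℝ) 1) isCompact_Icc
  refine ⟨L, LipschitzWith.of_dist_le_mul fun x y => ?_⟩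
  rw [← Real.smoothTransition.projIcc (x := x), ← Real.smoothTransition.projIcc (x := y)]
  refine (hL.dist_le_mul _ (Subtype.coe_prop _) _ (Subtype.coe_prop _)).trans ?_
  gcongr
  rw [← Subtype.dist_eq]
  simpa using (LipschitzWith.projIcc (zero_le_one (α := ℝ))).dist_le_mul x y

/-- The `k`-th layer of a smooth dyadic partition of unity on `(0, 1]`. -/
noncomputable def dyadicBump (k : ℕ) (t : ℝ) : ℝ :=
  Real.smoothTransition (2 ^ (k + 1) * t - 1) - Real.smoothTransition (2 ^ k * t - 1)

lemma abs_dyadicBump_le_one (k : ℕ) (t : ℝ) : |dyadicBump k t| ≤ 1 := by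
  unfold dyadicBump
  rw [abs_le]
  constructor <;>
  linarith [Real.smoothTransition.nonneg (2 ^ (k + 1) * t - 1),
    Real.smoothTransition.nonneg (2 ^ k * t - 1),
    Real.smoothTransition.le_one (2 ^ (k + 1) * t - 1),
    Real.smoothTransition.le_one (2 ^ k * t - 1)]

lemma dyadicBump_zero (k : ℕ) : dyadicBump k 0 = 0 := by simp [dyadicBump]

lemma dyadicBump_eq_zero {k : ℕ} {t : ℝ} (h : 2 ≤ 2 ^ k * t) : dyadicBump k t = 0 := by
  rw [dyadicBump, Real.smoothTransition.one_of_one_le, Real.smoothTransition.one_of_one_le,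
    sub_self]
  · linarith
  · rw [pow_succ]; linarith

lemma sum_dyadicBump {N : ℕ} {t : ℝ} (ht : t ≤ 1) (h : 2 ≤ 2 ^ N * t) :
    ∑ k ∈ Finset.range N, dyadicBump k t = 1 := by
  unfold dyadicBump
  rw [Finset.sum_range_sub (fun k => Real.smoothTransition (2 ^ k * t - 1)),
    Real.smoothTransition.one_of_one_le (by linarith),
    Real.smoothTransition.zero_of_nonpos (by simpa using ht), sub_zero]

lemma differentiable_dyadicBump (k : ℕ) : Differentiable ℝ (dyadicBump k) := by
  have := (Real.smoothTransition.contDiff (n := 1)).differentiable (by simp)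
  unfold dyadicBump
  fun_prop

lemma abs_dyadicBump_sub_le {L : NNReal} (hL : LipschitzWith L Real.smoothTransition) (k : ℕ)
    (t t' : ℝ) : |dyadicBump k t - dyadicBump k t'| ≤ 3 * L * 2 ^ k * |t - t'| := by
  have h : ∀ b : ℝ, 0 ≤ b → |Real.smoothTransition (b * t - 1) - Real.smoothTransition (b * t' - 1)|
      ≤ L * (b * |t - t'|) := by
    intro b hb
    have := hL.dist_le_mul (b * t - 1) (b * t' - 1)
    rwa [Real.dist_eq, Real.dist_eq, sub_sub_sub_cancel_right, ← mul_sub, abs_mul,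
      abs_of_nonneg hb] at this
  have e : dyadicBump k t - dyadicBump k t' =
      (Real.smoothTransition (2 ^ (k + 1) * t - 1) - Real.smoothTransition (2 ^ (k + 1) * t' - 1)) -
      (Real.smoothTransition (2 ^ k * t - 1) - Real.smoothTransition (2 ^ k * t' - 1)) := by
    unfold dyadicBump; ring
  rw [e]
  refine (abs_sub _ _).trans ((add_le_add (h _ (by positivity)) (h _ (by positivity))).trans ?_)
  rw [pow_succ]
  exact le_of_eq (by ring)

/-- A superposition of rescaled copies of `u`, of frequency increasing as `t → 0`. -/
noncomputable def layeredSum (u : ℝ → ℝ) (t x : ℝ) : ℝ :=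
  ∑' k : ℕ, dyadicBump k t * (u (4 ^ (k + 3) * x) / 4 ^ (k + 3))

section layeredSum

variable {u : ℝ → ℝ}

lemma layeredSum_zero_left (u : ℝ → ℝ) (x : ℝ) : layeredSum u 0 x = 0 := by
  simp [layeredSum, dyadicBump_zero]

lemma layeredSum_intCast (hu0 : ∀ m : ℤ, u m = 0) (t : ℝ) (m : ℤ) : layeredSum u t m = 0 := by
  have : ∀ k : ℕ, u (4 ^ (k + 3) * m) = 0 := fun k => by
    have := hu0 (4 ^ (k + 3) * m)
    push_cast at this
    exact this
  simp [layeredSum, this]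

lemma abs_layer_le (hu1 : ∀ x, |u x| ≤ 1) (k : ℕ) (x : ℝ) :
    |u (4 ^ (k + 3) * x) / 4 ^ (k + 3)| ≤ (1 / 64) * (1 / 4) ^ k := by
  rw [abs_div, abs_of_pos (by positivity : (0 : ℝ) < 4 ^ (k + 3)), div_le_iff₀ (by positivity)]
  have : (1 / 64 : ℝ) * (1 / 4) ^ k * 4 ^ (k + 3) = 1 := by
    rw [pow_add, one_div_pow]
    field_simp
    norm_num
  rw [this]
  exact hu1 _

lemma abs_layeredSum_term_le (hu1 : ∀ x, |u x| ≤ 1) (k : ℕ) (t x : ℝ) :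
    ‖dyadicBump k t * (u (4 ^ (k + 3) * x) / 4 ^ (k + 3))‖ ≤ (1 / 64) * (1 / 4) ^ k := by
  rw [Real.norm_eq_abs, abs_mul]
  exact (mul_le_of_le_one_left (abs_nonneg _) (abs_dyadicBump_le_one k t)).trans
    (abs_layer_le hu1 k x)

lemma hasSum_layer_bound :
    HasSum (fun k : ℕ => (1 / 64 : ℝ) * (1 / 4) ^ k) (1 / 48) := by
  have := (hasSum_geometric_of_lt_one (r := (1 / 4 : ℝ)) (by norm_num) (by norm_num)).mul_left
    (1 / 64)
  convert! this using 1
  norm_num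

lemma summable_layeredSum (hu1 : ∀ x, |u x| ≤ 1) (t x : ℝ) :
    Summable fun k : ℕ => dyadicBump k t * (u (4 ^ (k + 3) * x) / 4 ^ (k + 3)) :=
  .of_norm_bounded hasSum_layer_bound.summable fun k => abs_layeredSum_term_le hu1 k t x

lemma abs_layeredSum_le (hu1 : ∀ x, |u x| ≤ 1) (t x : ℝ) : |layeredSum u t x| ≤ 1 / 48 :=
  tsum_of_norm_bounded hasSum_layer_bound fun k => abs_layeredSum_term_le hu1 k t x

lemma layeredSum_holder {a C : ℝ} (ha1 : a < 1) (hC : 0 ≤ C) (hu1 : ∀ x, |u x| ≤ 1)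
    (hu : ∀ x y, |u x - u y| ≤ C * |x - y| ^ a) :
    ∃ A, 0 ≤ A ∧ ∀ t t' x x',
      |layeredSum u t x - layeredSum u t' x'| ≤ A * (|t - t'| + |x - x'| ^ a) := by
  obtain ⟨L, hL⟩ := smoothTransition_lipschitz
  set q : ℝ := (4 : ℝ) ^ (a - 1) with hq
  have hq0 : 0 < q := by positivity
  have hq1 : q < 1 := Real.rpow_lt_one_of_one_lt_of_neg (by norm_num) (by linarith)
  have hs1 : Summable fun k : ℕ => 3 * (L : ℝ) * (1 / 64) * (1 / 2) ^ k :=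
    (summable_geometric_of_lt_one (by norm_num) (by norm_num)).mul_left _
  have hs2 : Summable fun k : ℕ => C * q ^ 3 * q ^ k :=
    (summable_geometric_of_lt_one hq0.le hq1).mul_left _
  set B : ℕ → ℝ := fun k => 3 * (L : ℝ) * (1 / 64) * (1 / 2) ^ k + C * q ^ 3 * q ^ k with hB
  have hBs : Summable B := hs1.add hs2
  have hB0 : ∀ k, 0 ≤ B k := fun k => by positivity
  refine ⟨∑' k, B k, tsum_nonneg hB0, fun t t' x x' => ?_⟩
  rw [layeredSum, layeredSum, ← Real.norm_eq_abs, ← (summable_layeredSum hu1 t x).tsum_sub (summable_layeredSum hu1 t' x')]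
  refine tsum_of_norm_bounded (hBs.hasSum.mul_right (|t - t'| + |x - x'| ^ a)) fun k => ?_
  set M : ℝ := 4 ^ (k + 3) with hM
  have hM0 : 0 < M := by positivity
  have hlay : |u (M * x) / M - u (M * x') / M| ≤ C * q ^ 3 * q ^ k * |x - x'| ^ a := by
    rw [← sub_div, abs_div, abs_of_pos hM0]
    have h1 := hu (M * x) (M * x')
    rw [← mul_sub, abs_mul, abs_of_pos hM0, Real.mul_rpow hM0.le (abs_nonneg _)] at h1
    have hMq : M ^ a / M = q ^ 3 * q ^ k := by
      rw [← pow_add, add_comm 3 k, hq, Real.rpow_pow_comm (by norm_num), ← hM, Real.rpow_sub_one hM0.ne']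
    calc |u (M * x) - u (M * x')| / M ≤ C * (M ^ a * |x - x'| ^ a) / M := by gcongr
      _ = C * (M ^ a / M) * |x - x'| ^ a := by ring
      _ = _ := by rw [hMq]; ring
  have e : dyadicBump k t * (u (M * x) / M) - dyadicBump k t' * (u (M * x') / M) =
      (dyadicBump k t - dyadicBump k t') * (u (M * x) / M) +
      dyadicBump k t' * (u (M * x) / M - u (M * x') / M) := by ring
  have hxa : 0 ≤ |x - x'| ^ a := by positivity
  calc ‖dyadicBump k t * (u (M * x) / M) - dyadicBump k t' * (u (M * x') / M)‖
      ≤ |dyadicBump k t - dyadicBump k t'| * |u (M * x) / M| +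
        |dyadicBump k t'| * |u (M * x) / M - u (M * x') / M| := by
        rw [e, Real.norm_eq_abs, ← abs_mul, ← abs_mul]
        exact abs_add_le _ _
    _ ≤ (3 * L * 2 ^ k * |t - t'|) * ((1 / 64) * (1 / 4) ^ k) +
        1 * (C * q ^ 3 * q ^ k * |x - x'| ^ a) := by
        gcongr
        · exact abs_dyadicBump_sub_le hL k t t'
        · exact abs_layer_le hu1 k x
        · exact abs_dyadicBump_le_one k t'
    _ = 3 * L * (1 / 64) * (1 / 2) ^ k * |t - t'| + C * q ^ 3 * q ^ k * |x - x'| ^ a := by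
        have : (1 / 2 : ℝ) ^ k = 2 ^ k * (1 / 4) ^ k := by rw [← mul_pow]; norm_num
        rw [this]
        ring
    _ ≤ B k * (|t - t'| + |x - x'| ^ a) := by
        simp only [hB]
        have h1 : 0 ≤ 3 * (L : ℝ) * (1 / 64) * (1 / 2) ^ k * |x - x'| ^ a := by positivity
        have h2 : 0 ≤ C * q ^ 3 * q ^ k * |t - t'| := by positivity
        linarith

lemma layeredSum_hasFDerivAt {t x : ℝ} (ht : 0 < t) (ht1 : t ≤ 1)
    (hx : ∀ k : ℕ, HasDerivAt u (-1) (4 ^ (k + 3) * x)) :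
    ∃ A : ℝ, HasFDerivAt (fun z : ℝ × ℝ => layeredSum u z.1 z.2)
      (A • ContinuousLinearMap.fst ℝ ℝ ℝ - ContinuousLinearMap.snd ℝ ℝ ℝ) (t, x) := by
  obtain ⟨N, hN⟩ := pow_unbounded_of_one_lt (4 / t) (one_lt_two (α := ℝ))
  rw [div_lt_iff₀ ht] at hN
  have hloc : ∀ t', t / 2 < t' → ∀ y, layeredSum u t' y =
      ∑ k ∈ Finset.range N, dyadicBump k t' * (u (4 ^ (k + 3) * y) / 4 ^ (k + 3)) := by
    intro t' ht' y
    refine tsum_eq_sum fun k hk => ?_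
    have hNk : (2 : ℝ) ^ N ≤ 2 ^ k :=
      pow_le_pow_right₀ one_le_two (by simpa using hk)
    rw [dyadicBump_eq_zero, zero_mul]
    have : (2 : ℝ) ^ N * (t / 2) ≤ 2 ^ k * t' := by gcongr
    linarith
  have hev : (fun z : ℝ × ℝ => layeredSum u z.1 z.2) =ᶠ[𝓝 (t, x)] fun z : ℝ × ℝ =>
      ∑ k ∈ Finset.range N, dyadicBump k z.1 * (u (4 ^ (k + 3) * z.2) / 4 ^ (k + 3)) := by
    have : ∀ᶠ z : ℝ × ℝ in 𝓝 (t, x), t / 2 < z.1 :=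
      continuousAt_fst.eventually (Ioi_mem_nhds (show t / 2 < t by linarith))
    filter_upwards [this] with z hz using hloc z.1 hz z.2
  have hterm : ∀ k : ℕ, HasFDerivAt
      (fun z : ℝ × ℝ => dyadicBump k z.1 * (u (4 ^ (k + 3) * z.2) / 4 ^ (k + 3)))
      ((deriv (dyadicBump k) t * (u (4 ^ (k + 3) * x) / 4 ^ (k + 3))) •
        ContinuousLinearMap.fst ℝ ℝ ℝ - dyadicBump k t • ContinuousLinearMap.snd ℝ ℝ ℝ) (t, x) := by
    intro k
    have hM : (4 : ℝ) ^ (k + 3) ≠ 0 := by positivity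
    have h1 : HasFDerivAt (fun z : ℝ × ℝ => dyadicBump k z.1)
        (deriv (dyadicBump k) t • ContinuousLinearMap.fst ℝ ℝ ℝ) (t, x) :=
      HasDerivAt.comp_hasFDerivAt (f := Prod.fst) (t, x)
        (differentiable_dyadicBump k t).hasDerivAt hasFDerivAt_fst
    have h2 : HasDerivAt (fun y => u (4 ^ (k + 3) * y) / 4 ^ (k + 3)) (-1) x := by
      have := ((hx k).comp x ((hasDerivAt_id x).const_mul ((4 : ℝ) ^ (k + 3)))).div_const
        ((4 : ℝ) ^ (k + 3))
      simpa [Function.comp_def, hM] using this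
    have h3 : HasFDerivAt (fun z : ℝ × ℝ => u (4 ^ (k + 3) * z.2) / 4 ^ (k + 3))
        ((-1 : ℝ) • ContinuousLinearMap.snd ℝ ℝ ℝ) (t, x) :=
      HasDerivAt.comp_hasFDerivAt (f := Prod.snd) (t, x) h2 hasFDerivAt_snd
    convert! h1.mul h3 using 1
    ext <;> simp [mul_comm]
  refine ⟨∑ k ∈ Finset.range N, deriv (dyadicBump k) t * (u (4 ^ (k + 3) * x) / 4 ^ (k + 3)), ?_⟩
  refine HasFDerivAt.congr_of_eventuallyEq ?_ hev
  have := HasFDerivAt.fun_sum (u := Finset.range N) fun k _ => hterm k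
  convert! this using 1
  rw [Finset.sum_sub_distrib, ← Finset.sum_smul, ← Finset.sum_smul,
    sum_dyadicBump ht1 (by linarith), one_smul]

end layeredSum

/-- A map that is `a`-Hölder on a bounded set has finite Gagliardo energy of order `s < a`. -/
theorem gagliardoEnergy_lt_top_of_holder {n m : ℕ} (hn : 1 ≤ n) {s p a C : ℝ} (hp : 0 < p)
    (hsa : s < a) (hC : 0 ≤ C) {Ω : Set (EuclideanSpace ℝ (Fin n))}
    (hΩ : MeasurableSet Ω) (hb : Bornology.IsBounded Ω)
    {f : EuclideanSpace ℝ (Fin n) → EuclideanSpace ℝ (Fin m)}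
    (hf : ∀ x ∈ Ω, ∀ y ∈ Ω, ‖f x - f y‖ ≤ C * ‖x - y‖ ^ a) :
    gagliardoEnergy s p Ω f < ⊤ := by
  obtain ⟨R, hR⟩ := hb.subset_ball 0
  set β : ℝ := n + s * p - a * p with hβ
  set g : EuclideanSpace ℝ (Fin n) → ℝ := fun z => C ^ p * ‖z‖ ^ (-β) with hg
  have hgm : Measurable g := by fun_prop
  have hg0 : ∀ z, 0 ≤ g z := fun z => by positivity
  have hint : IntegrableOn g (Metric.ball 0 (2 * R)) volume := by
    refine integrableOn_ball_of_norm_le_rpow (C := C ^ p) (α := β) (by simpa using hn) ?_ ?_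
      hgm.aestronglyMeasurable
    · rw [finrank_euclideanSpace_fin, hβ]
      nlinarith
    · refine .of_forall fun z => ?_
      rw [Real.norm_eq_abs, abs_of_nonneg (hg0 z)]
  set I : ENNReal := ∫⁻ z in Metric.ball 0 (2 * R), ENNReal.ofReal (g z) with hI
  have hIfin : I < ⊤ := hint.lintegral_lt_top
  have hpt : ∀ x ∈ Ω, ∀ y ∈ Ω,
      ‖f x - f y‖ ^ p / ‖x - y‖ ^ ((n : ℝ) + s * p) ≤ g (x - y) := by
    intro x hx y hy
    rcases eq_or_ne x y with rfl | hxy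
    · rw [sub_self, norm_zero, Real.zero_rpow hp.ne', zero_div]
      exact hg0 _
    · have hpos : 0 < ‖x - y‖ := norm_pos_iff.2 (sub_ne_zero.2 hxy)
      have h1 : ‖f x - f y‖ ^ p ≤ C ^ p * ‖x - y‖ ^ (a * p) := by
        rw [Real.rpow_mul hpos.le, ← Real.mul_rpow hC (by positivity)]
        exact Real.rpow_le_rpow (norm_nonneg _) (hf x hx y hy) hp.le
      calc ‖f x - f y‖ ^ p / ‖x - y‖ ^ ((n : ℝ) + s * p)
          ≤ C ^ p * ‖x - y‖ ^ (a * p) / ‖x - y‖ ^ ((n : ℝ) + s * p) := by gcongr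
        _ = g (x - y) := by
          rw [hg, mul_div_assoc, ← Real.rpow_sub hpos]
          simp only [hβ]
          ring_nf
  have hinner : ∀ x ∈ Ω, ∫⁻ y in Ω, ENNReal.ofReal
      (‖f x - f y‖ ^ p / ‖x - y‖ ^ ((n : ℝ) + s * p)) ≤ I := by
    intro x hx
    set G : EuclideanSpace ℝ (Fin n) → ENNReal :=
      (Metric.ball 0 (2 * R)).indicator fun z => ENNReal.ofReal (g z) with hG
    calc ∫⁻ y in Ω, ENNReal.ofReal (‖f x - f y‖ ^ p / ‖x - y‖ ^ ((n : ℝ) + s * p))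
        ≤ ∫⁻ y in Ω, G (x - y) := by
          refine setLIntegral_mono' hΩ fun y hy => ?_
          have hmem : x - y ∈ Metric.ball (0 : EuclideanSpace ℝ (Fin n)) (2 * R) := by
            have h1 := mem_ball_zero_iff.1 (hR hx)
            have h2 := mem_ball_zero_iff.1 (hR hy)
            rw [mem_ball_zero_iff]
            linarith [norm_sub_le x y]
          rw [hG, Set.indicator_of_mem hmem]
          exact ENNReal.ofReal_le_ofReal (hpt x hx y hy)
      _ ≤ ∫⁻ y, G (x - y) := setLIntegral_le_lintegral _ _
      _ = ∫⁻ z, G z := lintegral_sub_left_eq_self G x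
      _ = I := lintegral_indicator Metric.isOpen_ball.measurableSet _
  calc gagliardoEnergy s p Ω f ≤ ∫⁻ _ in Ω, I := setLIntegral_mono' hΩ hinner
    _ = I * volume Ω := by rw [setLIntegral_const]
    _ < ⊤ := ENNReal.mul_lt_top hIfin hb.measure_lt_top

lemma continuousOn_of_holder {E F : Type*} [SeminormedAddCommGroup E] [SeminormedAddCommGroup F]
    {a C : ℝ} (ha : 0 < a) {Ω : Set E} {f : E → F}
    (hf : ∀ x ∈ Ω, ∀ y ∈ Ω, ‖f x - f y‖ ≤ C * ‖x - y‖ ^ a) : ContinuousOn f Ω := by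
  intro x hx
  rw [ContinuousWithinAt, tendsto_iff_norm_sub_tendsto_zero]
  refine squeeze_zero' (.of_forall fun _ => norm_nonneg _)
    (eventually_nhdsWithin_of_forall fun y hy => hf y hy x hx) ?_
  have : Continuous fun y : E => C * ‖y - x‖ ^ a :=
    continuous_const.mul ((by fun_prop : Continuous fun y : E => ‖y - x‖).rpow_const
      fun _ => Or.inr ha.le)
  have h := (this.tendsto x).mono_left (nhdsWithin_le_nhds (s := Ω))
  simpa [Real.zero_rpow ha.ne'] using h

lemma isCompact_closedCube (n : ℕ) : IsCompact (closedCube n) := by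
  have h : IsCompact (Set.pi univ fun _ : Fin n => Icc (-1 : ℝ) 1) :=
    isCompact_univ_pi fun _ => isCompact_Icc
  have := (EuclideanSpace.equiv (Fin n) ℝ).toHomeomorph.isCompact_preimage.2 h
  convert! this using 1
  ext x
  simp only [closedCube, abs_le, Set.mem_preimage, Set.mem_pi, Set.mem_univ, true_imp_iff,
    Set.mem_Icc]
  rfl

lemma isOpen_openCube (n : ℕ) : IsOpen (openCube n) := by
  have : openCube n = ⋂ i, {x : EuclideanSpace ℝ (Fin n) | |x i| < 1} := by
    ext x; simp [openCube]
  rw [this]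
  exact isOpen_iInter_of_finite fun i => isOpen_lt (by fun_prop) continuous_const

lemma exists_abs_eq_one_of_mem_frontier {n : ℕ} {x : EuclideanSpace ℝ (Fin n)}
    (hx : x ∈ frontier (closedCube n)) : ∃ i, |x i| = 1 := by
  have hcl : x ∈ closedCube n := (isCompact_closedCube n).isClosed.frontier_subset hx
  have hop : x ∉ openCube n := fun h =>
    hx.2 (interior_maximal (fun y hy i => (hy i).le) (isOpen_openCube n) h)
  simp only [openCube, mem_ofPred_eq, not_forall, not_lt] at hop
  obtain ⟨i, hi⟩ := hop
  exact ⟨i, le_antisymm (hcl i) hi⟩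

lemma ae_coord {n : ℕ} (i : Fin n) {P : ℝ → Prop} (h : ∀ᵐ t : ℝ, P t) :
    ∀ᵐ x : EuclideanSpace ℝ (Fin n), P (x i) :=
  ((Measure.quasiMeasurePreserving_eval (fun _ : Fin n => (volume : Measure ℝ)) i).comp
    (PiLp.volume_preserving_ofLp (Fin n)).quasiMeasurePreserving).ae h

lemma det_id_add_smulRight {n : ℕ} (φ : EuclideanSpace ℝ (Fin n) →L[ℝ] ℝ)
    (v : EuclideanSpace ℝ (Fin n)) :
    (ContinuousLinearMap.id ℝ (EuclideanSpace ℝ (Fin n)) + φ.smulRight v).det = 1 + φ v := by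
  have h := LinearMap.transvection.det (R := ℝ) (φ : EuclideanSpace ℝ (Fin n) →ₗ[ℝ] ℝ) v
  rw [ContinuousLinearMap.det]
  convert! h using 2

section construction

variable {n : ℕ} (i₀ : Fin n)

/-- A polynomial that vanishes on the faces of the cube not orthogonal to the axis `i₀`. -/
noncomputable def lateralWeight (x : EuclideanSpace ℝ (Fin n)) : ℝ :=
  ∏ i ∈ Finset.univ.erase i₀, (1 - x i ^ 2)

/-- The reflection in the axis `i₀`, perturbed along that axis by a layered sum of `u`. -/
noncomputable def perturbedReflection (u : ℝ → ℝ) (x : EuclideanSpace ℝ (Fin n)) :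
    EuclideanSpace ℝ (Fin n) :=
  x + (-2 * x i₀ - 2 * layeredSum u (lateralWeight i₀ x) (x i₀)) • EuclideanSpace.single i₀ 1

lemma contDiff_lateralWeight : ContDiff ℝ 1 (lateralWeight i₀) := by
  unfold lateralWeight
  fun_prop

lemma lateralWeight_le_one {x : EuclideanSpace ℝ (Fin n)} (hx : x ∈ closedCube n) :
    lateralWeight i₀ x ≤ 1 :=
  Finset.prod_le_one (fun i _ => by have := (sq_le_one_iff_abs_le_one _).2 (hx i); linarith)
    fun i _ => by linarith [sq_nonneg (x i)]

lemma lateralWeight_pos {x : EuclideanSpace ℝ (Fin n)} (hx : x ∈ openCube n) :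
    0 < lateralWeight i₀ x :=
  Finset.prod_pos fun i _ => by have := (sq_lt_one_iff_abs_lt_one _).2 (hx i); linarith

lemma lateralWeight_eq_zero {x : EuclideanSpace ℝ (Fin n)} {i : Fin n} (hi : i ≠ i₀)
    (hx : |x i| = 1) : lateralWeight i₀ x = 0 := by
  refine Finset.prod_eq_zero (Finset.mem_erase.2 ⟨hi, Finset.mem_univ i⟩) ?_
  rw [← sq_abs, hx]; norm_num

lemma reflectFirst_eq (h0 : (i₀ : ℕ) = 0) (x : EuclideanSpace ℝ (Fin n)) :
    reflectFirst x = x + (-2 * x i₀) • EuclideanSpace.single i₀ 1 := by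
  ext i
  by_cases h : i = i₀
  · subst h
    simp [reflectFirst, h0]
    ring
  · have : (i : ℕ) ≠ 0 := fun h' => h (Fin.ext (h'.trans h0.symm))
    simp [reflectFirst, this, h]

lemma perturbedReflection_sub_reflectFirst (h0 : (i₀ : ℕ) = 0) (u : ℝ → ℝ)
    (x : EuclideanSpace ℝ (Fin n)) : perturbedReflection i₀ u x - reflectFirst x =
      (-2 * layeredSum u (lateralWeight i₀ x) (x i₀)) • EuclideanSpace.single i₀ 1 := by
  rw [reflectFirst_eq i₀ h0, perturbedReflection, add_sub_add_left_eq_sub, ← sub_smul]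
  congr 1
  ring

lemma norm_reflectFirst_sub_perturbedReflection_le (h0 : (i₀ : ℕ) = 0) {u : ℝ → ℝ}
    (hu1 : ∀ x, |u x| ≤ 1) (x : EuclideanSpace ℝ (Fin n)) :
    ‖reflectFirst x - perturbedReflection i₀ u x‖ ≤ 1 / 24 := by
  rw [norm_sub_rev, perturbedReflection_sub_reflectFirst i₀ h0, norm_smul]
  have := abs_layeredSum_le hu1 (lateralWeight i₀ x) (x i₀)
  simp only [norm_mul, norm_neg, Real.norm_eq_abs, abs_two, PiLp.norm_single, abs_one]
  linarith

lemma perturbedReflection_eq_of_mem_frontier (h0 : (i₀ : ℕ) = 0) {u : ℝ → ℝ}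
    (hu0 : ∀ m : ℤ, u m = 0) {x : EuclideanSpace ℝ (Fin n)}
    (hx : x ∈ frontier (closedCube n)) : perturbedReflection i₀ u x = reflectFirst x := by
  obtain ⟨i, hi⟩ := exists_abs_eq_one_of_mem_frontier hx
  rw [← sub_eq_zero, perturbedReflection_sub_reflectFirst i₀ h0]
  suffices layeredSum u (lateralWeight i₀ x) (x i₀) = 0 by rw [this]; simp
  by_cases h : i = i₀
  · subst h
    rcases (abs_eq zero_le_one).1 hi with h | h
    · simpa [h] using layeredSum_intCast hu0 (lateralWeight i x) 1
    · simpa [h] using layeredSum_intCast hu0 (lateralWeight i x) (-1)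
  · rw [lateralWeight_eq_zero i₀ h hi, layeredSum_zero_left]

lemma perturbedReflection_holder {a C : ℝ} (ha : 0 < a) (ha1 : a < 1) (hC : 0 ≤ C) {u : ℝ → ℝ}
    (hu1 : ∀ x, |u x| ≤ 1) (hu : ∀ x y, |u x - u y| ≤ C * |x - y| ^ a) :
    ∃ B, 0 ≤ B ∧ ∀ x ∈ closedCube n, ∀ y ∈ closedCube n,
      ‖perturbedReflection i₀ u x - perturbedReflection i₀ u y‖ ≤ B * ‖x - y‖ ^ a := by
  obtain ⟨A, hA, hS⟩ := layeredSum_holder ha1 hC hu1 hu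
  obtain ⟨R, hR0, hR⟩ := (isCompact_closedCube n).isBounded.subset_closedBall_lt 0 0
  obtain ⟨L, hL⟩ := (contDiff_lateralWeight i₀).contDiffOn.exists_lipschitzOnWith one_ne_zero
    (convex_closedBall 0 R) (isCompact_closedBall 0 R)
  refine ⟨(3 + 2 * A * L) * (2 * R) ^ (1 - a) + 2 * A, by positivity, fun x hx y hy => ?_⟩
  set r := ‖x - y‖ with hr
  have hr0 : 0 ≤ r := norm_nonneg _
  have hcoord : |x i₀ - y i₀| ≤ r := by
    simpa using PiLp.norm_apply_le (x - y) i₀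
  have hrR : r ≤ 2 * R := by
    have h1 := mem_closedBall_zero_iff.1 (hR hx)
    have h2 := mem_closedBall_zero_iff.1 (hR hy)
    linarith [norm_sub_le x y]
  have hra : r ≤ (2 * R) ^ (1 - a) * r ^ a := by
    rcases hr0.eq_or_lt with h | h
    · rw [← h, Real.zero_rpow ha.ne', mul_zero]
    · calc r = r ^ (1 - a) * r ^ a := by
            rw [← Real.rpow_add h, sub_add_cancel, Real.rpow_one]
        _ ≤ _ := by
            gcongr
  have hlat : |lateralWeight i₀ x - lateralWeight i₀ y| ≤ L * r := by
    simpa [Real.dist_eq, dist_eq_norm] using hL.dist_le_mul x (hR hx) y (hR hy)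
  have hpow : |x i₀ - y i₀| ^ a ≤ r ^ a := Real.rpow_le_rpow (abs_nonneg _) hcoord ha.le
  set S := fun z : EuclideanSpace ℝ (Fin n) => layeredSum u (lateralWeight i₀ z) (z i₀) with hSdef
  have hSb : |S x - S y| ≤ A * (L * r + r ^ a) :=
    (hS _ _ _ _).trans (by gcongr)
  have e : perturbedReflection i₀ u x - perturbedReflection i₀ u y = (x - y) +
      (-2 * (x i₀ - y i₀) - 2 * (S x - S y)) • EuclideanSpace.single i₀ (1 : ℝ) := by
    simp only [perturbedReflection, hSdef]
    module
  calc ‖perturbedReflection i₀ u x - perturbedReflection i₀ u y‖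
      ≤ r + |-2 * (x i₀ - y i₀) - 2 * (S x - S y)| := by
        rw [e]
        refine (norm_add_le _ _).trans_eq ?_
        rw [norm_smul, PiLp.norm_single, norm_one, mul_one, Real.norm_eq_abs]
    _ ≤ r + (2 * |x i₀ - y i₀| + 2 * |S x - S y|) := by
        gcongr
        refine (abs_sub _ _).trans_eq ?_
        rw [abs_mul, abs_mul, abs_neg, abs_two]
    _ ≤ (3 + 2 * A * L) * r + 2 * A * r ^ a := by linarith
    _ ≤ (3 + 2 * A * L) * ((2 * R) ^ (1 - a) * r ^ a) + 2 * A * r ^ a := by gcongr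
    _ = _ := by ring

lemma perturbedReflection_ae_differentiable {u : ℝ → ℝ} (hu : ∀ᵐ x : ℝ, HasDerivAt u (-1) x) :
    ∀ᵐ x ∂(volume.restrict (closedCube n)),
      DifferentiableAt ℝ (perturbedReflection i₀ u) x ∧
        (fderiv ℝ (perturbedReflection i₀ u) x).det = 1 := by
  have hu' : ∀ᵐ t : ℝ, ∀ k : ℕ, HasDerivAt u (-1) (4 ^ (k + 3) * t) := by
    rw [ae_all_iff]
    intro k
    exact (Measure.quasiMeasurePreserving_smul (volume : Measure ℝ)
      (r := (4 : ℝ) ^ (k + 3)) (by positivity)).ae hu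
  have hface : ∀ᵐ x : EuclideanSpace ℝ (Fin n), ∀ i, x i ≠ 1 ∧ x i ≠ -1 := by
    rw [ae_all_iff]
    exact fun i => ae_coord i ((Measure.ae_ne volume 1).and (Measure.ae_ne volume (-1)))
  filter_upwards [ae_restrict_of_ae (ae_coord i₀ hu'), ae_restrict_of_ae hface,
    ae_restrict_mem (isCompact_closedCube n).measurableSet] with x hx hxf hxc
  have hxo : x ∈ openCube n := fun i => lt_of_le_of_ne (hxc i) fun h => by
    rcases (abs_eq zero_le_one).1 h with h | h
    · exact (hxf i).1 h
    · exact (hxf i).2 h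
  obtain ⟨A, hA⟩ := layeredSum_hasFDerivAt (lateralWeight_pos i₀ hxo)
    (lateralWeight_le_one i₀ hxc) hx
  set π : EuclideanSpace ℝ (Fin n) →L[ℝ] ℝ := EuclideanSpace.proj i₀ with hπ
  set D := fderiv ℝ (lateralWeight i₀) x with hD
  have hd : HasFDerivAt (lateralWeight i₀) D x :=
    ((contDiff_lateralWeight i₀).differentiable one_ne_zero x).hasFDerivAt
  have hp : HasFDerivAt (fun z : EuclideanSpace ℝ (Fin n) => z i₀) π x := π.hasFDerivAt
  have hDe : D (EuclideanSpace.single i₀ 1) = 0 := by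
    have hline : HasDerivAt (fun h : ℝ => x + h • EuclideanSpace.single i₀ (1 : ℝ))
        (EuclideanSpace.single i₀ (1 : ℝ)) 0 := by
      simpa using ((hasDerivAt_id (0 : ℝ)).smul_const (EuclideanSpace.single i₀ (1 : ℝ))).const_add x
    have h1 : HasDerivAt (lateralWeight i₀ ∘ fun h : ℝ => x + h • EuclideanSpace.single i₀ (1 : ℝ))
        (D (EuclideanSpace.single i₀ 1)) 0 :=
      HasFDerivAt.comp_hasDerivAt (0 : ℝ) (by simpa using hd) hline
    have h2 : (lateralWeight i₀ ∘ fun h : ℝ => x + h • EuclideanSpace.single i₀ (1 : ℝ)) =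
        fun _ => lateralWeight i₀ x := by
      funext h
      simp only [Function.comp_apply, lateralWeight]
      refine Finset.prod_congr rfl fun i hi => ?_
      simp [(Finset.mem_erase.1 hi).1]
    rw [h2] at h1
    exact h1.unique (hasDerivAt_const _ _)
  have hS : HasFDerivAt (fun z : EuclideanSpace ℝ (Fin n) =>
      layeredSum u (lateralWeight i₀ z) (z i₀)) (A • D - π) x := by
    have := HasFDerivAt.comp x hA (hd.prodMk hp)
    convert! this using 1
  have hf : HasFDerivAt (perturbedReflection i₀ u) (ContinuousLinearMap.id ℝ _ +
      ((-2 : ℝ) • π - (2 : ℝ) • (A • D - π)).smulRight (EuclideanSpace.single i₀ 1)) x :=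
    (hasFDerivAt_id x).add (((hp.const_mul (-2)).sub (hS.const_mul 2)).smul_const _)
  refine ⟨hf.differentiableAt, ?_⟩
  rw [hf.fderiv, det_id_add_smulRight]
  simp [hDe, hπ]

lemma not_sensePreserving_perturbedReflection (h0 : (i₀ : ℕ) = 0) {u : ℝ → ℝ}
    (hu1 : ∀ x, |u x| ≤ 1) (hu0 : ∀ m : ℤ, u m = 0) :
    ¬ SensePreserving (perturbedReflection i₀ u) (openCube n) := by
  intro hsp
  set U := Metric.ball (0 : EuclideanSpace ℝ (Fin n)) (1 / 2) with hU
  have hclU : closure U = Metric.closedBall 0 (1 / 2) := closure_ball _ (by norm_num)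
  have hfrU : frontier U = Metric.sphere 0 (1 / 2) := frontier_ball _ (by norm_num)
  have hf0 : perturbedReflection i₀ u 0 = 0 := by
    have := layeredSum_intCast hu0 (lateralWeight i₀ 0) 0
    simp only [Int.cast_zero] at this
    simp [perturbedReflection, this]
  have hnorm : ∀ x : EuclideanSpace ℝ (Fin n), ‖reflectFirst x‖ = ‖x‖ := by
    intro x
    rw [EuclideanSpace.norm_eq, EuclideanSpace.norm_eq]
    congr 1
    refine Finset.sum_congr rfl fun i _ => ?_
    by_cases h : (i : ℕ) = 0 <;> simp [reflectFirst, h]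
  have hclose := norm_reflectFirst_sub_perturbedReflection_le i₀ h0 hu1
  have hsphere : ∀ x ∈ frontier U, 1 / 4 ≤ ‖perturbedReflection i₀ u x‖ := by
    intro x hx
    rw [hfrU, mem_sphere_zero_iff_norm] at hx
    have h1 := norm_sub_norm_le (reflectFirst x) (perturbedReflection i₀ u x)
    rw [hnorm, hx] at h1
    linarith [hclose x]
  have hne : (perturbedReflection i₀ u '' frontier U).Nonempty := by
    refine ⟨_, EuclideanSpace.single i₀ (1 / 2 : ℝ), ?_, rfl⟩
    rw [hfrU, mem_sphere_zero_iff_norm, PiLp.norm_single]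
    norm_num
  have hinf : 1 / 4 ≤ Metric.infDist 0 (perturbedReflection i₀ u '' frontier U) := by
    rw [Metric.le_infDist hne]
    rintro _ ⟨x, hx, rfl⟩
    rw [dist_zero_left]
    exact hsphere x hx
  have hR : ∀ x, HasFDerivAt (reflectFirst (n := n)) (ContinuousLinearMap.id ℝ _ +
      ((-2 : ℝ) • (EuclideanSpace.proj i₀ : EuclideanSpace ℝ (Fin n) →L[ℝ] ℝ)).smulRight
        (EuclideanSpace.single i₀ 1)) x := by
    intro x
    rw [show reflectFirst (n := n) = _ from funext (reflectFirst_eq i₀ h0)]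
    exact (hasFDerivAt_id x).add ((((EuclideanSpace.proj i₀ :
      EuclideanSpace ℝ (Fin n) →L[ℝ] ℝ).hasFDerivAt).const_mul (-2)).smul_const _)
  have hdet : ∀ x, (fderiv ℝ (reflectFirst (n := n)) x).det = -1 := by
    intro x
    rw [(hR x).fderiv, det_id_add_smulRight]
    simp
    norm_num
  have hpre : {x | x ∈ U ∧ reflectFirst x = 0} = {(0 : EuclideanSpace ℝ (Fin n))} := by
    ext x
    simp only [mem_ofPred_eq, mem_singleton_iff, hU]
    constructor
    · rintro ⟨-, h⟩
      rw [← norm_eq_zero, ← hnorm, h, norm_zero]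
    · rintro rfl
      exact ⟨by simp, by rw [← norm_eq_zero, hnorm, norm_zero]⟩
  have hdeg : HasBrouwerDegree (perturbedReflection i₀ u) U 0 (-1) := by
    refine ⟨reflectFirst, ?_, fun x _ => ?_, fun x _ _ => by rw [hdet]; norm_num, ?_⟩
    · rw [show reflectFirst (n := n) = _ from funext (reflectFirst_eq i₀ h0)]
      fun_prop
    · linarith [hclose x]
    · rw [smoothDegree, hpre, finsum_mem_singleton, hdet]
      simp
  have hsub : closure U ⊆ openCube n := by
    intro x hx i
    rw [hclU, mem_closedBall_zero_iff] at hx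
    have := PiLp.norm_apply_le x i
    rw [Real.norm_eq_abs] at this
    linarith
  have := hsp U Metric.isOpen_ball (Metric.isConnected_ball (by norm_num))
    (hclU ▸ isCompact_closedBall _ _) hsub 0
    ⟨⟨0, by simp [hU], hf0⟩, fun ⟨x, hx, hx0⟩ => by
      have := hsphere x hx
      rw [hx0, norm_zero] at this
      norm_num at this⟩ (-1) hdeg
  norm_num at this

end construction

theorem theorem1p3 (n : ℕ) (hn : 2 ≤ n) (s : ℝ) (hs : s ∈ Set.Ioo (0 : ℝ) 1)
    (p : ℝ) (hp : 1 < p) :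
    ∃ f : EuclideanSpace ℝ (Fin n) → EuclideanSpace ℝ (Fin n),
      ContinuousOn f (closedCube n) ∧
      MemFracSobolev s p (closedCube n) f ∧
      (∀ᵐ x ∂(volume.restrict (closedCube n)),
        DifferentiableAt ℝ f x ∧ 0 < (fderiv ℝ f x).det) ∧
      (∀ x ∈ frontier (closedCube n), f x = reflectFirst x) ∧
      ¬ SensePreserving f (openCube n) := by
  obtain ⟨a, hsa, ha1⟩ := exists_between hs.2
  have ha : 0 < a := hs.1.trans hsa
  obtain ⟨C, u, hC, hu1, hu0, hu, hud⟩ := exists_periodic_holder_deriv_neg_one ha ha1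
  have hpos : 0 < n := by omega
  let i₀ : Fin n := ⟨0, hpos⟩
  obtain ⟨B, hB, hf⟩ := perturbedReflection_holder i₀ ha ha1 hC hu1 hu
  have hcomp := isCompact_closedCube n
  have hcont : ContinuousOn (perturbedReflection i₀ u) (closedCube n) :=
    continuousOn_of_holder ha hf
  refine ⟨perturbedReflection i₀ u, hcont, ⟨?_, ?_⟩, ?_,
    fun x hx => perturbedReflection_eq_of_mem_frontier i₀ rfl hu0 hx,
    not_sensePreserving_perturbedReflection i₀ rfl hu1 hu0⟩
  · obtain ⟨M, hM⟩ := hcomp.exists_bound_of_continuousOn hcont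
    have : IsFiniteMeasure (volume.restrict (closedCube n)) :=
      ⟨by simpa using hcomp.measure_lt_top⟩
    exact MemLp.of_bound (hcont.aestronglyMeasurable hcomp.measurableSet) M
      ((ae_restrict_iff' hcomp.measurableSet).2 (.of_forall hM))
  · exact gagliardoEnergy_lt_top_of_holder hpos (by linarith) hsa hB hcomp.measurableSet
      hcomp.isBounded hf
  · filter_upwards [perturbedReflection_ae_differentiable i₀ hud] with x hx
    exact ⟨hx.1, by rw [hx.2]; norm_num⟩
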